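/- Let $D\subset\mathbb{R}^n$ be a bounded convex polyhedron (a bounded solution set of finitely many linear inequalities) and let $G:D\to\mathbb{R}$ be continuous and strictly convex, in the sense that $G$ is convex on $D$ and is not constant on any segment $[x,y]\subset D$ with $x\neq y$. Let $x^*$ be the minimizer of $G$ on $D$. A path $\varphi:[0,1]\to D$ is called admissible if it is continuous and $t\mapsto G(\varphi(t))$ does not increase on $[0,1]$. For $x,y\in D$ write $x\succsim y$ if there is an admissible path $\varphi$ with $\varphi(0)=x$ and $\varphi(1)=y$, and write $x\sim y$ if $x\succsim y$ and $y\succsim x$. The relation $\succsim$ is a preorder. Let $\mathcal{T}=D/{\sim}$ be the quotient space (the tree of $G$ in $D$), $\pi:D\to\mathcal{T}$ the natural projection, and give $\mathcal{T}$ the induced partial order: $\pi(x)\succsim\pi(y)$ if and only if $x\succsim y$. For $u,v\in\mathcal{T}$ with $v\succsim u$, the ordered segment $[u,v]$ is the set of all $z\in\mathcal{T}$ with $v\succsim z\succsim u$. Then for all $x,y\in D$ one has $\pi(x)\succsim\pi(x^*)$, so that the ordered segment $[\pi(x^*),\pi(x)]$ is defined, and an admissible path from $x$ to $y$ in $D$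 exists if and only if $$\pi(y)\in[\pi(x^*),\pi(x)].$$ -/

import Mathlib

/-- A convex polyhedron in `ℝⁿ`: the solution set of a finite system of linear inequalities
`A x ≤ b`. -/
def IsConvexPolyhedron {n : ℕ} (D : Set (EuclideanSpace ℝ (Fin n))) : Prop :=
  ∃ (m : ℕ) (A : Matrix (Fin m) (Fin n) ℝ) (b : Fin m → ℝ),
    D = {x | ∀ i, A.mulVec x.ofLp i ≤ b i}

/-- `G` is strictly convex in `D` in the sense that it is convex on `D` (equivalently, its
epigraph over `D` is convex) and it is not constant on any nondegenerate segment of `D`.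
This is implied by Mathlib's `StrictConvexOn ℝ D G`. -/
def IsConvexNonconstantOn {E : Type*} [AddCommGroup E] [Module ℝ E]
    (D : Set E) (G : E → ℝ) : Prop :=
  ConvexOn ℝ D G ∧ ∀ x ∈ D, ∀ y ∈ D, x ≠ y → ¬ ∃ c : ℝ, ∀ z ∈ segment ℝ x y, G z = c

section Tree

variable {E : Type*} [TopologicalSpace E]

/-- A path `φ : [0,1] → D` is admissible if it is continuous and `G ∘ φ` does not increase. -/
def IsAdmissiblePath (D : Set E) (G : E → ℝ) (φ : unitInterval → D) : Prop :=
  Continuous φ ∧ Antitone fun t => G (φ t)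

/-- `x ≿ y`: there is an admissible path in `D` from `x` to `y`. -/
def Precedes (D : Set E) (G : E → ℝ) (x y : D) : Prop :=
  ∃ φ : unitInterval → D, IsAdmissiblePath D G φ ∧ φ 0 = x ∧ φ 1 = y

theorem Precedes.refl (D : Set E) (G : E → ℝ) (x : D) : Precedes D G x x :=
  ⟨fun _ => x, ⟨continuous_const, antitone_const⟩, rfl, rfl⟩

theorem Precedes.trans {D : Set E} {G : E → ℝ} {x y z : D}
    (hxy : Precedes D G x y) (hyz : Precedes D G y z) : Precedes D G x z := by
  obtain ⟨f, ⟨hfc, hfa⟩, hf0, hf1⟩ := hxy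
  obtain ⟨g, ⟨hgc, hga⟩, hg0, hg1⟩ := hyz
  let p : Path x y := { toFun := f, continuous_toFun := hfc, source' := hf0, target' := hf1 }
  let q : Path y z := { toFun := g, continuous_toFun := hgc, source' := hg0, target' := hg1 }
  refine ⟨p.trans q, ⟨(p.trans q).continuous, ?_⟩, (p.trans q).source, (p.trans q).target⟩
  have hpy : ∀ t, G y ≤ G (p t) := fun t => by
    have h : G (f 1) ≤ G (f t) := hfa t.2.2
    rw [hf1] at h
    exact h
  have hqy : ∀ t, G (q t) ≤ G y := fun t => by
    have h : G (g t) ≤ G (g 0) := hga t.2.1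
    rw [hg0] at h
    exact h
  intro s t hst
  have hst' : (s : ℝ) ≤ t := hst
  simp only [Path.trans_apply]
  split_ifs with ht hs hs
  · refine hfa ?_
    change 2 * (s : ℝ) ≤ 2 * (t : ℝ)
    linarith
  · exact absurd (hst'.trans ht) hs
  · exact (hqy _).trans (hpy _)
  · refine hga ?_
    change 2 * (s : ℝ) - 1 ≤ 2 * (t : ℝ) - 1
    linarith

/-- The equivalence `x ∼ y` on `D`: `x ≿ y` and `y ≿ x`. -/
def admissibleSetoid (D : Set E) (G : E → ℝ) : Setoid D where
  r x y := Precedes D G x y ∧ Precedes D G y x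
  iseqv :=
    { refl := fun x => ⟨Precedes.refl D G x, Precedes.refl D G x⟩
      symm := fun h => ⟨h.2, h.1⟩
      trans := fun h k => ⟨h.1.trans k.1, k.2.trans h.2⟩ }

/-- The tree of `G` in `D`: the quotient `D / ∼`. -/
def LevelTree (D : Set E) (G : E → ℝ) : Type _ := Quotient (admissibleSetoid D G)

/-- The tree carries the quotient topology. -/
instance LevelTree.instTopologicalSpace (D : Set E) (G : E → ℝ) : TopologicalSpace (LevelTree D G) :=
  inferInstanceAs (TopologicalSpace (Quotient (admissibleSetoid D G)))

/-- The natural projection `π : D → D / ∼`. -/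
def LevelTree.proj (D : Set E) (G : E → ℝ) (x : D) : LevelTree D G :=
  Quotient.mk (admissibleSetoid D G) x

/-- The partial order on the tree induced by the preorder on `D`: `u ≤ v` stands for `v ≿ u`,
so that `π(y) ≤ π(x)` if and only if `x ≿ y`, and `G` is monotone for `≤`. -/
instance LevelTree.instPartialOrder (D : Set E) (G : E → ℝ) : PartialOrder (LevelTree D G) where
  le := Quotient.lift₂ (fun y x : D => Precedes D G x y) (by
    intro a b c d hac hbd
    exact propext ⟨fun h => hbd.2.trans (h.trans hac.1), fun h => hbd.1.trans (h.trans hac.2)⟩)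
  le_refl := by
    rintro ⟨x⟩
    exact Precedes.refl D G x
  le_trans := by
    rintro ⟨x⟩ ⟨y⟩ ⟨z⟩ hxy hyz
    exact Precedes.trans (D := D) (G := G) hyz hxy
  le_antisymm := by
    rintro ⟨x⟩ ⟨y⟩ hxy hyx
    exact Quotient.sound ⟨hyx, hxy⟩

theorem LevelTree.proj_le_proj_iff (D : Set E) (G : E → ℝ) (x y : D) :
    LevelTree.proj D G y ≤ LevelTree.proj D G x ↔ Precedes D G x y := Iff.rfl

/-- The ordered segment `[u, v]` of the tree with lower end `u` and upper end `v`
(used for `v ≿ u`): all `z` with `v ≿ z ≿ u`. -/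
def LevelTree.orderedSegment {D : Set E} {G : E → ℝ} (u v : LevelTree D G) : Set (LevelTree D G) :=
  {z | z ≤ v ∧ u ≤ z}

end Tree

/-! The order on the tree is reachability by admissible paths, so `π(y) ≤ π(x)` already says that
such a path leads from `x` to `y`. The content is that `π(xmin)` is the least element of the tree:
the straight segment from any point to `xmin` is admissible (`Precedes.of_convexOn_of_forall_le`).
The lower bound in the ordered segment is then automatic. -/

/-- A convex function does not increase along a segment that ends at one of its minimizers, so
every point of the domain descends to the minimizer. -/
theorem Precedes.of_convexOn_of_forall_le {E : Type*} [AddCommGroup E] [Module ℝ E]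
    [TopologicalSpace E] [IsTopologicalAddGroup E] [ContinuousSMul ℝ E] {D : Set E} {G : E → ℝ}
    (hG : ConvexOn ℝ D G) {m : D} (hm : ∀ z : D, G m ≤ G z) (x : D) : Precedes D G x m := by
  let ℓ : ℝ →ᵃ[ℝ] E := AffineMap.lineMap (x : E) (m : E)
  have hℓ : ∀ t : unitInterval, ℓ t ∈ D := fun t => hG.1.lineMap_mem x.2 m.2 t.2
  have hconv := hG.comp_affineMap ℓ
  have hℓ1 : ℓ 1 = m := AffineMap.lineMap_apply_one _ _
  refine ⟨fun t => ⟨ℓ t, hℓ t⟩, ⟨?_, fun s t hst => ?_⟩, Subtype.ext ?_, Subtype.ext ?_⟩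
  · exact (AffineMap.lineMap_continuous.comp continuous_subtype_val).subtype_mk _
  -- For `s ≤ t ≤ 1`, convexity along the line bounds the value at `t` by the larger of the values
  -- at `s` and at `1`; since `ℓ 1 = m` is a minimizer, that maximum is the value at `s`.
  · have h := hconv.le_max_of_mem_Icc (hℓ s) (hℓ 1) (z := (t : ℝ)) ⟨hst, t.2.2⟩
    refine h.trans (max_le le_rfl ?_)
    simpa [hℓ1] using hm ⟨ℓ s, hℓ s⟩
  · simp [ℓ]
  · simp [ℓ]

theorem corollary3p4 {n : ℕ} (D : Set (EuclideanSpace ℝ (Fin n)))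
    (hD : IsConvexPolyhedron D) (hDb : Bornology.IsBounded D)
    (G : EuclideanSpace ℝ (Fin n) → ℝ) (hGcont : ContinuousOn G D)
    (hGconv : IsConvexNonconstantOn D G)
    (xmin : D) (hxmin : ∀ z : D, G xmin ≤ G z) (x y : D) :
    LevelTree.proj D G xmin ≤ LevelTree.proj D G x ∧
      ((∃ φ : unitInterval → D, IsAdmissiblePath D G φ ∧ φ 0 = x ∧ φ 1 = y) ↔
        LevelTree.proj D G y ∈
          LevelTree.orderedSegment (LevelTree.proj D G xmin) (LevelTree.proj D G x)) := by
  have hmin : ∀ z : D, Precedes D G z xmin := Precedes.of_convexOn_of_forall_le hGconv.1 hxmin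
  -- Only `π(y) ≤ π(x)` carries information; `π(xmin) ≤ π(y)` is `hmin y`, whatever `x` is.
  exact ⟨(LevelTree.proj_le_proj_iff D G x xmin).2 (hmin x),
    fun h => ⟨(LevelTree.proj_le_proj_iff D G x y).2 h,
      (LevelTree.proj_le_proj_iff D G y xmin).2 (hmin y)⟩,
    fun h => (LevelTree.proj_le_proj_iff D G x y).1 h.1⟩
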